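/- Let $\overline{\mathbb R}=[-\infty,\infty]$ and $\mathbb D=\overline{\mathbb R}\times\overline{\mathbb R}$. A rectangle is a set $R=[x_1,x_2]\times[y_1,y_2]\subseteq\mathbb D$ with $x_1<x_2$, $y_1<y_2$ in $\overline{\mathbb R}$. Its main corners are $(x_1,y_1),(x_2,y_2)$, its opposite corners are $(x_2,y_1),(x_1,y_2)$, and for $F:\mathbb D\to\mathbb R$ put $V_F(R)=F(x_1,y_1)+F(x_2,y_2)-F(x_2,y_1)-F(x_1,y_2)$. A function $F:\mathbb D\to[0,1]$ with $F(x,-\infty)=F(-\infty,y)=0$ for all $x,y$ and $F(\infty,\infty)=1$ is called a distribution if $V_F(R)\ge 0$ for every rectangle $R$, and a quasi-distribution if $V_F(R)\ge0$ for every rectangle $R$ that contains a point with at least one infinite coordinate (no continuity is required). Its margins are the functions $x\mapsto F(x,\infty)$ and $y\mapsto F(\infty,y)$. For a rectangle $R$ let $m_R(\mathbf x)$ be $1$ if $\mathbf x$ is a main corner of $R$, $-1$ if it is an opposite corner, and $0$ otherwise. Let $\mathfrak R$ be the set of all finite formal disjoint unions $R=\bigsqcup_{i=1}^n R_i$ of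 rectangles (that is, finite multisets of rectangles, which may overlap), and put $m_R=\sum_{i=1}^n m_{R_i}$. For functions $A\le B$ from $\mathbb D$ to $\mathbb R$ let $$L^{(A,B)}(R)=\sum_{\mathbf y:\,m_R(\mathbf y)>0}B(\mathbf y)\,m_R(\mathbf y)+\sum_{\mathbf y:\,m_R(\mathbf y)<0}A(\mathbf y)\,m_R(\mathbf y),$$ $$P_M^{(A,B)}(\mathbf x)=\inf_{R\in\mathfrak R,\;m_R(\mathbf x)>0}\frac{L^{(A,B)}(R)}{m_R(\mathbf x)},\qquad P_O^{(A,B)}(\mathbf x)=\inf_{R\in\mathfrak R,\;m_R(\mathbf x)<0}\frac{L^{(A,B)}(R)}{-m_R(\mathbf x)},$$ where $\inf\emptyset=+\infty$. **Theorem.** Let $A\le B$ be quasi-distributions with the same margins $F_X$ and $F_Y$, let $\mathcal D(A,B)$ be the set of all distributions $F$ with margins $F_X$ and $F_Y$ such that $A\le F\le B$ pointwise, and suppose that $\mathcal D(A,B)\ne\emptyset$. Then (a) $B$ is the pointwise supremum of $\mathcal D(A,B)$ if and only if $B(\mathbf x)-A(\mathbf x)\le P_O^{(A,B)}(\mathbf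 x)$ for all $\mathbf x\in\mathbb D$; (b) $A$ is the pointwise infimum of $\mathcal D(A,B)$ if and only if $B(\mathbf x)-A(\mathbf x)\le P_M^{(A,B)}(\mathbf x)$ for all $\mathbf x\in\mathbb D$. -/

import Mathlib

/-- A nondegenerate closed rectangle with sides parallel to the axes in the extended plane
`[-∞, ∞]²`, given by its south-west corner `sw` and its north-east corner `ne`. -/
structure ExtRect where
  sw : EReal × EReal
  ne : EReal × EReal
  fst_lt : sw.1 < ne.1
  snd_lt : sw.2 < ne.2

namespace ExtRect

/-- The south-east corner. -/
def se (r : ExtRect) : EReal × EReal := (r.ne.1, r.sw.2)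

/-- The north-west corner. -/
def nw (r : ExtRect) : EReal × EReal := (r.sw.1, r.ne.2)

/-- The rectangle as a set of points. -/
def carrier (r : ExtRect) : Set (EReal × EReal) := Set.Icc r.sw r.ne

/-- The `F`-volume of a rectangle. -/
def volume (F : EReal × EReal → ℝ) (r : ExtRect) : ℝ :=
  F r.sw + F r.ne - F r.se - F r.nw

/-- The multiplicity of a point with respect to one rectangle: `1` at the main corners
(south-west, north-east), `-1` at the opposite corners (south-east, north-west), `0` elsewhere. -/
noncomputable def mult (r : ExtRect) (x : EReal × EReal) : ℤ :=
  if x = r.sw ∨ x = r.ne then 1 else if x = r.se ∨ x = r.nw then -1 else 0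

end ExtRect

/-- The boundary of the extended plane: points with an infinite coordinate. -/
def extBoundary : Set (EReal × EReal) :=
  {x | x.1 = ⊥ ∨ x.1 = ⊤ ∨ x.2 = ⊥ ∨ x.2 = ⊤}

/-- A function with values in `[0,1]` that is grounded and equals `1` at `(∞, ∞)`. -/
structure IsGroundedUnit (F : EReal × EReal → ℝ) : Prop where
  mem_Icc : ∀ x, F x ∈ Set.Icc (0 : ℝ) 1
  fst_bot : ∀ y, F (⊥, y) = 0
  snd_bot : ∀ x, F (x, ⊥) = 0
  top_top : F (⊤, ⊤) = 1

/-- Bivariate quasi-distribution: volumes are nonnegative on every rectangle that meets the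
boundary. No continuity is required. -/
structure IsQuasiDistribution (F : EReal × EReal → ℝ) : Prop extends IsGroundedUnit F where
  volume_nonneg : ∀ r : ExtRect, (r.carrier ∩ extBoundary).Nonempty → 0 ≤ r.volume F

/-- Bivariate distribution: volumes are nonnegative on every rectangle. -/
structure IsDistribution (F : EReal × EReal → ℝ) : Prop extends IsGroundedUnit F where
  volume_nonneg : ∀ r : ExtRect, 0 ≤ r.volume F

/-- `F` has the univariate margins `FX` and `FY`. -/
def HasMargins (F : EReal × EReal → ℝ) (FX FY : EReal → ℝ) : Prop :=
  (∀ x, F (x, ⊤) = FX x) ∧ (∀ y, F (⊤, y) = FY y)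

/-- The quasi-distributions with margins `FX`, `FY`. -/
def quasiDistributions (FX FY : EReal → ℝ) : Set (EReal × EReal → ℝ) :=
  {F | IsQuasiDistribution F ∧ HasMargins F FX FY}

/-- The distributions with margins `FX`, `FY`. -/
def distributions (FX FY : EReal → ℝ) : Set (EReal × EReal → ℝ) :=
  {F | IsDistribution F ∧ HasMargins F FX FY}

/-- The distributions with margins `FX`, `FY` lying pointwise between `A` and `B`. -/
def distributionsBetween (FX FY : EReal → ℝ) (A B : EReal × EReal → ℝ) :
    Set (EReal × EReal → ℝ) :=
  {F | F ∈ distributions FX FY ∧ A ≤ F ∧ F ≤ B}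

/-- The multiplicity of a point with respect to a finite (formal) disjoint union of rectangles,
modelled as a multiset of rectangles: they may overlap and may be repeated. -/
noncomputable def rectMult (R : Multiset ExtRect) (x : EReal × EReal) : ℤ :=
  (R.map fun r => r.mult x).sum

/-- Only finitely many points have nonzero multiplicity, so the sums in `rectL` are finite. -/
theorem rectMult_support_finite (R : Multiset ExtRect) :
    (Function.support (rectMult R)).Finite := by
  induction R using Multiset.induction_on with
  | empty =>
    have h : Function.support (rectMult 0) = ∅ := by
      ext x
      simp [rectMult]
    rw [h]
    exact Set.finite_empty
  | cons r R ih =>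
    have hr : (({r.sw, r.ne, r.se, r.nw} : Set (EReal × EReal))).Finite := by simp
    refine (hr.union ih).subset fun x hx => ?_
    by_contra hn
    rw [Set.mem_union, not_or] at hn
    obtain ⟨h1, h2⟩ := hn
    simp only [Set.mem_insert_iff, Set.mem_singleton_iff, not_or] at h1
    apply hx
    have h3 : rectMult R x = 0 := by simpa using h2
    have h4 : rectMult (r ::ₘ R) x = r.mult x + rectMult R x := by simp [rectMult]
    rw [h4, h3]
    simp [ExtRect.mult, h1]

/-- `L^{(A,B)}(R)`: the sum of `m_R(y) B(y)` over points of positive multiplicity plus the sum of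
`m_R(y) A(y)` over points of negative multiplicity. -/
noncomputable def rectL (A B : EReal × EReal → ℝ) (R : Multiset ExtRect) : ℝ :=
  (∑ᶠ y ∈ {y | 0 < rectMult R y}, B y * (rectMult R y : ℝ)) +
    ∑ᶠ y ∈ {y | rectMult R y < 0}, A y * (rectMult R y : ℝ)

/-- `P_M^{(A,B)}(x)`; the infimum is taken in `[-∞, ∞]`, so it is `+∞` over the empty set. -/
noncomputable def rectPM (A B : EReal × EReal → ℝ) (x : EReal × EReal) : EReal :=
  ⨅ R ∈ {R : Multiset ExtRect | 0 < rectMult R x},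
    ((rectL A B R / (rectMult R x : ℝ) : ℝ) : EReal)

/-- `P_O^{(A,B)}(x)`; the infimum is taken in `[-∞, ∞]`, so it is `+∞` over the empty set. -/
noncomputable def rectPO (A B : EReal × EReal → ℝ) (x : EReal × EReal) : EReal :=
  ⨅ R ∈ {R : Multiset ExtRect | rectMult R x < 0},
    ((rectL A B R / (-(rectMult R x : ℝ)) : ℝ) : EReal)

/-! ### Corner multiplicities and volumes -/

namespace ExtRect

/-! The number `rectL A B R` is the maximum, over `F` in the box `[A, B]`, of the total volume of
`R`. By a Farkas-type duality the box contains a function with all volumes nonnegative if and only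
if `rectL A B R ≥ 0` for every `R`. Necessity is `rectL_nonneg`; sufficiency,
`exists_volume_nonneg_of_rectL_nonneg`, comes from compactness and Hahn–Banach.

The value `B x` is attained at `x` exactly when the box stays feasible after `A` is raised to `B x`
at the single point `x`. This changes `rectL` only when `x` has negative multiplicity, and then by
`(B x - A x) * rectMult R x`, which gives the bound by `rectPO`. Lowering `B` to `A x` gives
`rectPM` in the same way. -/

theorem mult_eq (r : ExtRect) (y : EReal × EReal) :
    (r.mult y : ℝ) = (if y = r.sw then 1 else 0) + (if y = r.ne then 1 else 0)
      - (if y = r.se then 1 else 0) - (if y = r.nw then 1 else 0) := by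
  have h1 := r.fst_lt.ne
  have h2 := r.snd_lt.ne
  have a1 : r.sw ≠ r.ne := fun h => h1 (congrArg Prod.fst h)
  have a2 : r.sw ≠ r.se := fun h => h1 (congrArg Prod.fst h : r.sw.1 = r.se.1)
  have a3 : r.sw ≠ r.nw := fun h => h2 (congrArg Prod.snd h : r.sw.2 = r.nw.2)
  have a4 : r.ne ≠ r.se := fun h => h2 (congrArg Prod.snd h).symm
  have a5 : r.ne ≠ r.nw := fun h => h1 (congrArg Prod.fst h).symm
  have a6 : r.se ≠ r.nw := fun h => h1 (congrArg Prod.fst h).symm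
  unfold mult
  by_cases e1 : y = r.sw
  · subst e1; simp [a1, a2, a3]
  by_cases e2 : y = r.ne
  · subst e2; simp [a1.symm, a4, a5]
  by_cases e3 : y = r.se
  · subst e3; simp [a2.symm, a4.symm, a6]
  by_cases e4 : y = r.nw
  · subst e4; simp [a3.symm, a5.symm, a6.symm]
  simp [e1, e2, e3, e4]

theorem finsum_mul_mult (F : EReal × EReal → ℝ) (r : ExtRect) :
    ∑ᶠ y, F y * (r.mult y : ℝ) = r.volume F := by
  classical
  rw [finsum_eq_sum_of_support_subset (s := {r.sw, r.ne, r.se, r.nw})]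
  · simp only [mult_eq, mul_add, mul_sub, Finset.sum_add_distrib, Finset.sum_sub_distrib,
      mul_ite, mul_one, mul_zero, Finset.sum_ite_eq']
    simp [volume]
  · intro y hy
    by_contra hn
    simp only [Finset.coe_insert, Finset.coe_singleton, Set.mem_insert_iff,
      Set.mem_singleton_iff, not_or] at hn
    exact hy (by simp [mult, hn])

theorem continuous_volume (r : ExtRect) : Continuous fun F : EReal × EReal → ℝ => r.volume F := by
  unfold volume
  fun_prop

/-- The vector of volumes of a finite family of rectangles, as a continuous linear map. -/
def volumes {ι : Type*} (r : ι → ExtRect) : (EReal × EReal → ℝ) →L[ℝ] (ι → ℝ) where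
  toFun F i := (r i).volume F
  map_add' F G := by ext i; simp [volume]; ring
  map_smul' c F := by ext i; simp [volume]; ring
  cont := continuous_pi fun i => (r i).continuous_volume

end ExtRect

theorem support_mul_rectMult_finite (F : EReal × EReal → ℝ) (R : Multiset ExtRect) :
    (Function.support fun y => F y * (rectMult R y : ℝ)).Finite :=
  (rectMult_support_finite R).subset fun y hy h => hy (by simp [h])

theorem finsum_mul_rectMult (F : EReal × EReal → ℝ) (R : Multiset ExtRect) :
    ∑ᶠ y, F y * (rectMult R y : ℝ) = (R.map fun r => r.volume F).sum := by
  induction R using Multiset.induction_on with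
  | empty => simp [rectMult]
  | cons r R ih =>
    have h1 (y) : (rectMult (r ::ₘ R) y : ℝ) = (rectMult {r} y : ℝ) + rectMult R y := by
      simp [rectMult]
    have h2 (y) : (rectMult {r} y : ℝ) = r.mult y := by simp [rectMult]
    simp only [h1, mul_add]
    rw [finsum_add_distrib (support_mul_rectMult_finite F _) (support_mul_rectMult_finite F _), ih]
    simp only [h2, ExtRect.finsum_mul_mult, Multiset.map_cons, Multiset.sum_cons]

/-! ### `rectL` as a maximum over the box -/

/-- The function between `A` and `B` that maximises the total volume of `R`. -/
noncomputable def extremal (A B : EReal × EReal → ℝ) (R : Multiset ExtRect) :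
    EReal × EReal → ℝ :=
  fun y => if 0 < rectMult R y then B y else A y

theorem extremal_mem_Icc {A B : EReal × EReal → ℝ} (hAB : A ≤ B) (R : Multiset ExtRect) :
    extremal A B R ∈ Set.Icc A B := by
  constructor <;> intro y <;> unfold extremal <;> split_ifs <;> first | exact hAB y | exact le_rfl

theorem rectL_eq_finsum (A B : EReal × EReal → ℝ) (R : Multiset ExtRect) :
    rectL A B R = ∑ᶠ y, extremal A B R y * (rectMult R y : ℝ) := by
  unfold rectL
  rw [finsum_mem_def, finsum_mem_def, ← finsum_add_distrib]
  · refine finsum_congr fun y => ?_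
    rcases lt_trichotomy (rectMult R y) 0 with h | h | h
    · simp [extremal, h, h.not_gt]
    · simp [h]
    · simp [extremal, h, h.not_gt]
  · exact (support_mul_rectMult_finite B R).subset (by
      rw [Set.support_indicator]; exact Set.inter_subset_right)
  · exact (support_mul_rectMult_finite A R).subset (by
      rw [Set.support_indicator]; exact Set.inter_subset_right)

theorem rectL_eq_sum_volume (A B : EReal × EReal → ℝ) (R : Multiset ExtRect) :
    rectL A B R = (R.map fun r => r.volume (extremal A B R)).sum := by
  rw [rectL_eq_finsum, finsum_mul_rectMult]

theorem sum_volume_le_rectL {A B F : EReal × EReal → ℝ} (hF : F ∈ Set.Icc A B)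
    (R : Multiset ExtRect) : (R.map fun r => r.volume F).sum ≤ rectL A B R := by
  rw [← finsum_mul_rectMult, rectL_eq_finsum]
  rw [finsum_eq_sum_of_support_subset (s := (rectMult_support_finite R).toFinset) _
      (by intro y hy; simpa using fun h => hy (by simp [h])),
    finsum_eq_sum_of_support_subset (s := (rectMult_support_finite R).toFinset) _
      (by intro y hy; simpa using fun h => hy (by simp [h]))]
  refine Finset.sum_le_sum fun y _ => ?_
  by_cases h : 0 < rectMult R y
  · simp only [extremal, h, if_true]
    exact mul_le_mul_of_nonneg_right (hF.2 y) (by exact_mod_cast h.le)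
  · simp only [extremal, h, if_false]
    exact mul_le_mul_of_nonpos_right (hF.1 y) (by exact_mod_cast not_lt.mp h)

theorem rectL_nonneg {A B F : EReal × EReal → ℝ} (hF : F ∈ Set.Icc A B)
    (hV : ∀ r : ExtRect, 0 ≤ r.volume F) (R : Multiset ExtRect) : 0 ≤ rectL A B R := by
  refine (Multiset.sum_nonneg fun v hv => ?_).trans (sum_volume_le_rectL hF R)
  obtain ⟨r, -, rfl⟩ := Multiset.mem_map.mp hv
  exact hV r

theorem finsum_update_mul_rectMult (F : EReal × EReal → ℝ) (x : EReal × EReal) (c : ℝ)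
    (R : Multiset ExtRect) :
    ∑ᶠ y, Function.update F x c y * (rectMult R y : ℝ) =
      (∑ᶠ y, F y * (rectMult R y : ℝ)) + (c - F x) * rectMult R x := by
  have h1 : ∑ᶠ y, Pi.single (M := fun _ => ℝ) x (c - F x) y * (rectMult R y : ℝ)
      = (c - F x) * rectMult R x := by
    rw [finsum_eq_single _ x fun y hy => by simp [hy], Pi.single_eq_same]
  rw [← h1, ← finsum_add_distrib (support_mul_rectMult_finite _ _)
    (support_mul_rectMult_finite _ _)]
  refine finsum_congr fun y => ?_
  by_cases h : y = x
  · subst h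
    simp only [Function.update_self, Pi.single_eq_same]
    ring
  · simp [h]

/-- At positive multiplicity `rectL` does not see the lower bound, so there the correction has to
vanish; this is what `hc` ensures. -/
theorem rectL_update_left (A B : EReal × EReal → ℝ) {x : EReal × EReal} {c : ℝ}
    {R : Multiset ExtRect} (hc : 0 < rectMult R x → c = B x) :
    rectL (Function.update A x c) B R =
      rectL A B R + (c - extremal A B R x) * rectMult R x := by
  rw [rectL_eq_finsum, rectL_eq_finsum, ← finsum_update_mul_rectMult]
  refine finsum_congr fun y => ?_
  by_cases h : y = x
  · subst h
    by_cases hR : 0 < rectMult R y <;> simp [extremal, hR, hc]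
  · simp [extremal, h]

theorem rectL_update_right (A B : EReal × EReal → ℝ) {x : EReal × EReal} {c : ℝ}
    {R : Multiset ExtRect} (hc : ¬ 0 < rectMult R x → c = A x) :
    rectL A (Function.update B x c) R =
      rectL A B R + (c - extremal A B R x) * rectMult R x := by
  rw [rectL_eq_finsum, rectL_eq_finsum, ← finsum_update_mul_rectMult]
  refine finsum_congr fun y => ?_
  by_cases h : y = x
  · subst h
    by_cases hR : 0 < rectMult R y <;> simp [extremal, hR, hc]
  · simp [extremal, h]

/-! ### Duality on the box -/

/-- If a compact convex set of vectors misses the nonnegative orthant, some vector of natural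
numbers has negative pairing with all of its elements. -/
theorem exists_nat_weights_of_disjoint_orthant {ι : Type*} [Fintype ι] {S : Set (ι → ℝ)}
    (hc : IsCompact S) (hconv : Convex ℝ S) (hS : Disjoint S (Set.Ici 0)) :
    ∃ k : ι → ℕ, ∀ v ∈ S, ∑ i, (k i : ℝ) * v i < 0 := by
  classical
  obtain ⟨f, u, w, hu, huw, hw⟩ :=
    geometric_hahn_banach_compact_closed hconv hc (convex_Ici (𝕜 := ℝ) (0 : ι → ℝ)) isClosed_Ici hS
  have hw0 : w < 0 := by simpa using hw 0 (by simp)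
  have hf (v : ι → ℝ) : f v = ∑ i, f (Pi.single i 1) * v i := by
    conv_lhs => rw [← Finset.univ_sum_single v, map_sum]
    refine Finset.sum_congr rfl fun i _ => ?_
    rw [mul_comm, ← smul_eq_mul, ← map_smul, ← Pi.single_smul, smul_eq_mul, mul_one]
  have hpos (i) : 0 ≤ f (Pi.single i 1) := by
    by_contra! hneg
    -- A negative coefficient would give a point of the orthant where `f` equals `w`, although `f >
    -- w` there.
    have h := hw ((w / f (Pi.single i 1)) • Pi.single i 1) (by
      have : 0 ≤ w / f (Pi.single i 1) := div_nonneg_of_nonpos hw0.le hneg.le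
      have hs : (0 : ι → ℝ) ≤ Pi.single i 1 := Pi.single_nonneg.mpr zero_le_one
      exact smul_nonneg this hs)
    rw [map_smul, smul_eq_mul, div_mul_cancel₀ _ hneg.ne] at h
    exact h.false
  obtain ⟨M, hM⟩ := hc.isBounded.exists_norm_le
  -- Rounding the scaled weights up costs at most `M` per coordinate; `N` is so large that the gap
  -- `-N * u` absorbs the total.
  obtain ⟨N, hN⟩ := exists_nat_gt (Fintype.card ι * M / -u)
  have hu0 : 0 < -u := by linarith
  rw [div_lt_iff₀ hu0] at hN
  refine ⟨fun i => ⌈N * f (Pi.single i 1)⌉₊, fun v hv => ?_⟩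
  have hterm (i) : (⌈N * f (Pi.single i 1)⌉₊ : ℝ) * v i ≤ N * (f (Pi.single i 1) * v i) + M := by
    have h1 := Nat.le_ceil (N * f (Pi.single i 1))
    have h2 := Nat.ceil_lt_add_one (mul_nonneg N.cast_nonneg (hpos i))
    have h3 : |v i| ≤ M := (norm_le_pi_norm v i).trans (hM v hv)
    have h4 : (⌈N * f (Pi.single i 1)⌉₊ - N * f (Pi.single i 1)) * v i ≤ 1 * |v i| := by
      refine (mul_le_mul_of_nonneg_left (le_abs_self (v i)) (sub_nonneg.mpr h1)).trans ?_
      exact mul_le_mul_of_nonneg_right (by linarith) (abs_nonneg _)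
    nlinarith
  calc ∑ i, (⌈N * f (Pi.single i 1)⌉₊ : ℝ) * v i
      ≤ ∑ i, (N * (f (Pi.single i 1) * v i) + M) := Finset.sum_le_sum fun i _ => hterm i
    _ = N * f v + Fintype.card ι * M := by
        rw [Finset.sum_add_distrib, ← Finset.mul_sum, ← hf]; simp
    _ ≤ N * u + Fintype.card ι * M := by
        gcongr; exact (hu v hv).le
    _ < 0 := by linarith

/-- A function with nonnegative rectangle volumes fits between `A` and `B` as soon as `L^{(A,B)}`
is nonnegative. -/
theorem exists_volume_nonneg_of_rectL_nonneg {A B : EReal × EReal → ℝ} (hAB : A ≤ B)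
    (hL : ∀ R, 0 ≤ rectL A B R) :
    ∃ F ∈ Set.Icc A B, ∀ r : ExtRect, 0 ≤ r.volume F := by
  have hK : IsCompact (Set.Icc A B) := isCompact_Icc
  obtain ⟨F, hF, hV⟩ := hK.inter_iInter_nonempty (fun r : ExtRect => {F | 0 ≤ r.volume F})
    -- By compactness of the box in the product topology, finitely many rectangles `u` suffice.
    (fun r => isClosed_le continuous_const r.continuous_volume) fun u => by
      by_contra hne
      let T := ExtRect.volumes (fun i : u => (i : ExtRect))
      obtain ⟨k, hk⟩ := exists_nat_weights_of_disjoint_orthant (hK.image T.continuous)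
        ((convex_Icc A B).linear_image T.toLinearMap) (by
          rw [Set.disjoint_left]
          rintro _ ⟨F, hF, rfl⟩ hpos
          exact hne ⟨F, hF, Set.mem_iInter₂.mpr fun r hr => hpos ⟨r, hr⟩⟩)
      -- Integer weights become repetitions of rectangles; the extremal function then makes `rectL A
      -- B R` negative.
      let R : Multiset ExtRect := ∑ i : u, Multiset.replicate (k i) (i : ExtRect)
      have h := hk _ ⟨_, extremal_mem_Icc hAB R, rfl⟩
      have hR : rectL A B R = ∑ i : u, (k i : ℝ) * (i : ExtRect).volume (extremal A B R) := by
        rw [rectL_eq_sum_volume]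
        generalize extremal A B R = G
        change Multiset.sumAddMonoidHom
          (Multiset.mapAddMonoidHom (fun r : ExtRect => r.volume G) R) = _
        simp [R, map_sum]
      exact (hL R).not_gt (hR.trans_lt h)
  exact ⟨F, hF, fun r => Set.mem_iInter.mp hV r⟩

/-- `A` and `B` agree on the boundary, so any function between them inherits groundedness and
margins. -/
theorem mem_distributionsBetween {FX FY : EReal → ℝ} {A B F : EReal × EReal → ℝ}
    (hA : A ∈ quasiDistributions FX FY) (hB : B ∈ quasiDistributions FX FY)
    (hF : F ∈ Set.Icc A B) (hV : ∀ r : ExtRect, 0 ≤ r.volume F) :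
    F ∈ distributionsBetween FX FY A B := by
  obtain ⟨hA, hAX, hAY⟩ := hA
  obtain ⟨hB, hBX, hBY⟩ := hB
  have key {x c} (ha : A x = c) (hb : B x = c) : F x = c :=
    le_antisymm (hb ▸ hF.2 x) (ha ▸ hF.1 x)
  exact ⟨⟨⟨⟨fun x => ⟨(hA.mem_Icc x).1.trans (hF.1 x), (hF.2 x).trans (hB.mem_Icc x).2⟩,
    fun y => key (hA.fst_bot y) (hB.fst_bot y), fun x => key (hA.snd_bot x) (hB.snd_bot x),
    key hA.top_top hB.top_top⟩, hV⟩, fun x => key (hAX x) (hBX x),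
    fun y => key (hAY y) (hBY y)⟩, hF.1, hF.2⟩

/-! ### Pointwise criteria for the two bounds -/

theorem le_rectPO_iff {A B : EReal × EReal → ℝ} {x : EReal × EReal} {c : ℝ} :
    (c : EReal) ≤ rectPO A B x ↔ ∀ R, rectMult R x < 0 → 0 ≤ rectL A B R + c * rectMult R x := by
  simp only [rectPO, le_iInf_iff, Set.mem_ofPred_eq, EReal.coe_le_coe_iff]
  refine forall₂_congr fun R hR => ?_
  have hR' : (0 : ℝ) < -(rectMult R x : ℝ) := by exact_mod_cast neg_pos.mpr hR
  rw [le_div_iff₀ hR']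
  constructor <;> intro h <;> linarith

theorem le_rectPM_iff {A B : EReal × EReal → ℝ} {x : EReal × EReal} {c : ℝ} :
    (c : EReal) ≤ rectPM A B x ↔ ∀ R, 0 < rectMult R x → 0 ≤ rectL A B R - c * rectMult R x := by
  simp only [rectPM, le_iInf_iff, Set.mem_ofPred_eq, EReal.coe_le_coe_iff]
  refine forall₂_congr fun R hR => ?_
  have hR' : (0 : ℝ) < (rectMult R x : ℝ) := by exact_mod_cast hR
  rw [le_div_iff₀ hR', sub_nonneg]

theorem isLUB_apply_iff {FX FY : EReal → ℝ} {A B : EReal × EReal → ℝ}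
    (hA : A ∈ quasiDistributions FX FY) (hB : B ∈ quasiDistributions FX FY)
    (hAB : A ≤ B) (hD : (distributionsBetween FX FY A B).Nonempty) (x : EReal × EReal) :
    IsLUB ((fun F : EReal × EReal → ℝ => F x) '' distributionsBetween FX FY A B) (B x) ↔
      ((B x - A x : ℝ) : EReal) ≤ rectPO A B x := by
  rw [le_rectPO_iff]
  constructor
  · intro h R hR
    have hR' : (rectMult R x : ℝ) < 0 := by exact_mod_cast hR
    have hle : B x ≤ A x + rectL A B R / -(rectMult R x : ℝ) := by
      refine h.2 ?_
      rintro _ ⟨F, ⟨⟨hF, -⟩, hAF, hFB⟩, rfl⟩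
      -- Tightening the lower bound to `F x` at `x` keeps `F` in the box, so `rectL_nonneg` there
      -- bounds `F x` from above.
      have hmem : F ∈ Set.Icc (Function.update A x (F x)) B :=
        ⟨by rw [update_le_iff]; exact ⟨le_rfl, fun y _ => hAF y⟩, hFB⟩
      have h0 := rectL_nonneg hmem hF.volume_nonneg R
      rw [rectL_update_left A B fun h => absurd h hR.not_gt] at h0
      simp only [extremal, hR.not_gt, if_false] at h0
      change F x ≤ _
      rw [← sub_le_iff_le_add', le_div_iff₀ (neg_pos.mpr hR')]
      linarith
    rw [← sub_le_iff_le_add', le_div_iff₀ (neg_pos.mpr hR')] at hle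
    linarith
  · intro h
    obtain ⟨F₀, ⟨hF₀, -⟩, hAF₀, hF₀B⟩ := hD
    obtain ⟨F, hF, hV⟩ := exists_volume_nonneg_of_rectL_nonneg
      (A := Function.update A x (B x)) (B := B)
      (by rw [update_le_iff]; exact ⟨le_rfl, fun y _ => hAB y⟩) fun R => by
        rw [rectL_update_left A B fun _ => rfl]
        have h0 := rectL_nonneg ⟨hAF₀, hF₀B⟩ hF₀.volume_nonneg R
        rcases lt_trichotomy (rectMult R x) 0 with hR | hR | hR
        -- Only negative multiplicity at `x` needs the hypothesis on `rectPO`; otherwise `rectL` is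
        -- unchanged and `F₀` makes it nonnegative.
        · simpa [extremal, hR.not_gt] using h R hR
        · simpa [hR] using h0
        · simpa [extremal, hR] using h0
    have hA' : A ≤ Function.update A x (B x) := by
      rw [le_update_iff]; exact ⟨hAB x, fun _ _ => le_rfl⟩
    refine IsGreatest.isLUB
      ⟨⟨F, mem_distributionsBetween hA hB ⟨hA'.trans hF.1, hF.2⟩ hV, ?_⟩, ?_⟩
    · exact le_antisymm (hF.2 x) (by simpa using hF.1 x)
    · rintro _ ⟨G, hG, rfl⟩
      exact hG.2.2 x

theorem isGLB_apply_iff {FX FY : EReal → ℝ} {A B : EReal × EReal → ℝ}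
    (hA : A ∈ quasiDistributions FX FY) (hB : B ∈ quasiDistributions FX FY)
    (hAB : A ≤ B) (hD : (distributionsBetween FX FY A B).Nonempty) (x : EReal × EReal) :
    IsGLB ((fun F : EReal × EReal → ℝ => F x) '' distributionsBetween FX FY A B) (A x) ↔
      ((B x - A x : ℝ) : EReal) ≤ rectPM A B x := by
  rw [le_rectPM_iff]
  constructor
  · intro h R hR
    have hR' : 0 < (rectMult R x : ℝ) := by exact_mod_cast hR
    have hle : B x - rectL A B R / (rectMult R x : ℝ) ≤ A x := by
      refine h.2 ?_
      rintro _ ⟨F, ⟨⟨hF, -⟩, hAF, hFB⟩, rfl⟩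
      have hmem : F ∈ Set.Icc A (Function.update B x (F x)) :=
        ⟨hAF, by rw [le_update_iff]; exact ⟨le_rfl, fun y _ => hFB y⟩⟩
      have h0 := rectL_nonneg hmem hF.volume_nonneg R
      rw [rectL_update_right A B fun h => absurd hR h] at h0
      simp only [extremal, hR, if_true] at h0
      change _ ≤ F x
      rw [sub_le_comm, le_div_iff₀ hR']
      linarith
    rw [sub_le_comm, le_div_iff₀ hR'] at hle
    linarith
  · intro h
    obtain ⟨F₀, ⟨hF₀, -⟩, hAF₀, hF₀B⟩ := hD
    obtain ⟨F, hF, hV⟩ := exists_volume_nonneg_of_rectL_nonneg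
      (A := A) (B := Function.update B x (A x))
      (by rw [le_update_iff]; exact ⟨le_rfl, fun y _ => hAB y⟩) fun R => by
        rw [rectL_update_right A B fun _ => rfl]
        have h0 := rectL_nonneg ⟨hAF₀, hF₀B⟩ hF₀.volume_nonneg R
        rcases lt_trichotomy (rectMult R x) 0 with hR | hR | hR
        · simpa [extremal, hR.not_gt] using h0
        · simpa [hR] using h0
        · have := h R hR
          simp only [extremal, hR, if_true]
          linarith
    have hB' : Function.update B x (A x) ≤ B := by
      rw [update_le_iff]; exact ⟨hAB x, fun _ _ => le_rfl⟩
    refine IsLeast.isGLB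
      ⟨⟨F, mem_distributionsBetween hA hB ⟨hF.1, hF.2.trans hB'⟩ hV, ?_⟩, ?_⟩
    · exact le_antisymm (by simpa using hF.2 x) (hF.1 x)
    · rintro _ ⟨G, hG, rfl⟩
      exact hG.2.1 x

theorem theorem3p6 (FX FY : EReal → ℝ) (A B : EReal × EReal → ℝ)
    (hA : A ∈ quasiDistributions FX FY) (hB : B ∈ quasiDistributions FX FY)
    (hAB : A ≤ B) (hD : (distributionsBetween FX FY A B).Nonempty) :
    ((∀ x, IsLUB ((fun F : EReal × EReal → ℝ => F x) '' distributionsBetween FX FY A B) (B x)) ↔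
        ∀ x, ((B x - A x : ℝ) : EReal) ≤ rectPO A B x) ∧
      ((∀ x, IsGLB ((fun F : EReal × EReal → ℝ => F x) '' distributionsBetween FX FY A B) (A x)) ↔
        ∀ x, ((B x - A x : ℝ) : EReal) ≤ rectPM A B x) :=
  ⟨forall_congr' (isLUB_apply_iff hA hB hAB hD), forall_congr' (isGLB_apply_iff hA hB hAB hD)⟩
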